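/- Let $K$ be a field, let $n\ge 1$ be an integer, and let $k\in(0,n)$ be a real number that is not an integer. Put $s=\lfloor k\rfloor$. For a positive integer $D$, let $\mathcal I\sim\mathcal I(n,D,p)$ be the random monomial ideal of $R=K[x_1,\dots,x_n]$ generated by a random set of monomials, in which each monomial of degree between $1$ and $D$ is included independently with probability $p=D^{-k}$. For an ideal $I$ of $R$, let $\deg(I)$ be its degree: if $P$ is the polynomial with $P(t)=\dim_K\bigl(R_{\le t}/I_{\le t}\bigr)$ for all large integers $t$ (the subscript $\le t$ denotes elements of total degree at most $t$) and $d$ is the degree of $P$, then $\deg(I)$ is $d!$ times the leading coefficient of $P$; in particular, $\deg(I)=\dim_K(R/I)$ when $R/I$ is finite-dimensional over $K$. For an integer $m\ge 1$ and a real number $x$, let $Z(m,x)=\#\{\alpha\in\mathbb Z_{\ge 0}^m : \prod_{i=1}^m(\alpha_i+1)\le x\}$. Then there exist constants $C_1,C_2>0$ such that, for every $\epsilon>0$, with probability tending to $1$ as $D\to\infty$ both of the following hold: 1. $Z(n-s,D^{k-s-\epsilon})<\deg(\mathcal I)<Z(n-s,D^{k-s+\epsilon})$; 2. $C_1D^{k-s-\epsilon}(\log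 D)^{n-1}<\deg(\mathcal I)<C_2D^{k-s+\epsilon}(\log D)^{n-1}$. -/

import Mathlib

namespace RandomMonomialIdeal

/-- The (affine) Hilbert function of an ideal `I` of `K[x₁, …, xₙ]`: the dimension over `K` of
`R_{≤ t} / I_{≤ t}`, that is, of the image in `R / I` of the space of polynomials of total degree
at most `t`. -/
noncomputable def hilbertFunction {K : Type*} [Field K] {n : ℕ}
    (I : Ideal (MvPolynomial (Fin n) K)) (t : ℕ) : ℕ :=
  Module.finrank K
    ((MvPolynomial.restrictTotalDegree (Fin n) K t).map
      (Ideal.Quotient.mkₐ K I).toLinearMap)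

/-- `P` is the (affine) Hilbert polynomial of `I`: it agrees with the Hilbert function at all
large integers. -/
def IsHilbertPolynomial {K : Type*} [Field K] {n : ℕ}
    (I : Ideal (MvPolynomial (Fin n) K)) (P : Polynomial ℚ) : Prop :=
  ∀ᶠ t : ℕ in Filter.atTop, (hilbertFunction I t : ℚ) = P.eval (t : ℚ)

/-- The Hilbert polynomial is unique. -/
theorem IsHilbertPolynomial.unique {K : Type*} [Field K] {n : ℕ}
    {I : Ideal (MvPolynomial (Fin n) K)} {P Q : Polynomial ℚ}
    (hP : IsHilbertPolynomial I P) (hQ : IsHilbertPolynomial I Q) : P = Q := by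
  obtain ⟨N, hN⟩ := Filter.eventually_atTop.1 (hP.and hQ)
  refine Polynomial.eq_of_infinite_eval_eq P Q ?_
  refine ((Set.Ici_infinite N).image (Nat.cast_injective (R := ℚ)).injOn).mono ?_
  rintro _ ⟨t, ht, rfl⟩
  exact (hN t ht).1.symm.trans (hN t ht).2

open Classical in
/-- The degree of an ideal `I` of `K[x₁, …, xₙ]`: `d!` times the leading coefficient of its affine
Hilbert polynomial, where `d` is the degree of that polynomial (`d` is the dimension of `R / I`).
When `R / I` is finite dimensional over `K` this is `dim_K (R / I)`. -/
noncomputable def degree {K : Type*} [Field K] {n : ℕ}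
    (I : Ideal (MvPolynomial (Fin n) K)) : ℚ :=
  if h : ∃ P : Polynomial ℚ, IsHilbertPolynomial I P then
    (h.choose.natDegree.factorial : ℚ) * h.choose.leadingCoeff
  else 0

/-- The degree, computed from any polynomial that is the Hilbert polynomial. -/
theorem IsHilbertPolynomial.degree_eq {K : Type*} [Field K] {n : ℕ}
    {I : Ideal (MvPolynomial (Fin n) K)} {P : Polynomial ℚ} (hP : IsHilbertPolynomial I P) :
    degree I = (P.natDegree.factorial : ℚ) * P.leadingCoeff := by
  have h : ∃ P : Polynomial ℚ, IsHilbertPolynomial I P := ⟨P, hP⟩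
  rw [degree, dif_pos h, h.choose_spec.unique hP]

/-- The ideal of `K[x₁, …, xₙ]` generated by the monomials with exponents in `G`. -/
noncomputable def monomialIdeal (K : Type*) [Field K] {n : ℕ} (G : Set (Fin n →₀ ℕ)) :
    Ideal (MvPolynomial (Fin n) K) :=
  Ideal.span ((fun a => MvPolynomial.monomial a (1 : K)) '' G)

/-- The law of the random generating set of the Erdős–Rényi-type model `I(n, D, p)`: each monomial
(exponent vector) of degree between `1` and `D` is selected independently with probability `p`. -/
noncomputable def randomGenerators (n D : ℕ) (p : unitInterval) :
    MeasureTheory.Measure (Set (Fin n →₀ ℕ)) :=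
  ProbabilityTheory.setBernoulli {a : Fin n →₀ ℕ | 0 < a.degree ∧ a.degree ≤ D} p

/-- `Z n d` is the number of `α ∈ ℤ_{≥ 0}ⁿ` with `∏ (αᵢ + 1) ≤ d`. -/
noncomputable def Z (n : ℕ) (d : ℝ) : ℕ :=
  Set.ncard {a : Fin n → ℕ | (∏ i, ((a i : ℝ) + 1)) ≤ d}

end RandomMonomialIdeal

/-!
Both parts of the theorem follow from the single estimate that, for small `e > 0` and with high
probability, `D ^ (k - s - e) ≤ deg I ≤ D ^ (k - s + e) * (2 + log D) ^ n`
(`tendsto_randomGenerators_degree_bounds`): the hyperbola count satisfies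
`x - 1 < Z m x ≤ x * (1 + log D) ^ m` for `0 ≤ x ≤ D` and `m ≥ 1`, so it agrees with `x` up to
powers of `log D` and an additive constant, and powers of `log D` are negligible against `D ^ (ε - e)`. In
particular `C₁ = C₂ = 1` will do.

To compute the degree, note that the Hilbert function of a monomial ideal counts standard monomials.
The generators have exponents at most `D`, so whether an exponent vector is standard depends only on
its truncation at `D`. A truncated vector `b ∈ [0, D]ⁿ` with `r` coordinates equal to `D`
("saturated") is the truncation of `(t - |b| + r).choose r` vectors of degree at most `t`. Hence the
Hilbert polynomial is a sum of binomial polynomials, and in dimension `s` the degree is the number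
of standard vectors of the box with exactly `s` saturated coordinates (`degree_monomialIdeal`).

A vector `b` is standard if and only if none of the roughly `∏ (bᵢ + 1)` vectors below it is a
generator, and each of them is one with probability `D ^ (-k)`.

* Upper bound: with high probability every `b ∈ [0, D)ⁿ` with `∏ (bᵢ + 1) > D ^ (k + e)` lies above
  a generator. Since `k + e < s + 1`, a standard vector has at most `s` saturated coordinates, and
  if it has `s` of them, its other coordinates satisfy `∏ (bᵢ + 1) ≤ D ^ (k - s + e)`. Comparing
  with harmonic sums, there are at most `D ^ (k - s + e) * (2 + log D) ^ n` of those.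
* Lower bound: fix a set `T` of `s` coordinates and `j ∉ T`. The vector with entry `D` on `T`,
  entry about `D ^ (k - s - e)` at `j` and zero elsewhere has `O(D ^ (k - e))` vectors below it, so
  with high probability it is standard, and then so are all those with a smaller entry at `j`.
-/

open RandomMonomialIdeal MeasureTheory ProbabilityTheory Filter Topology

/-! ### The Hilbert function of a monomial ideal -/

/-- The standard exponents of the monomial ideal generated by `G`: those divisible by no
generator. -/
def standardExponents {n : ℕ} (G : Set (Fin n →₀ ℕ)) : Set (Fin n →₀ ℕ) :=
  {a | ∀ g ∈ G, ¬ g ≤ a}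

/-- The exponent vectors of the monomials of total degree at most `t`. -/
noncomputable def exponentsOfDegreeLE (n t : ℕ) : Finset (Fin n →₀ ℕ) :=
  (Finset.range (t + 1)).biUnion (Finset.finsuppAntidiag Finset.univ)

lemma mem_exponentsOfDegreeLE {n t : ℕ} {a : Fin n →₀ ℕ} :
    a ∈ exponentsOfDegreeLE n t ↔ a.degree ≤ t := by
  simp [exponentsOfDegreeLE, Finsupp.degree_eq_sum]

open Classical in
/-- The standard monomials of degree at most `t` form a basis of `R_{≤ t} / I_{≤ t}`. -/
lemma hilbertFunction_monomialIdeal (K : Type*) [Field K] {n : ℕ} (G : Set (Fin n →₀ ℕ)) (t : ℕ) :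
    hilbertFunction (monomialIdeal K G) t =
      ((exponentsOfDegreeLE n t).filter (· ∈ standardExponents G)).card := by
  set S := (exponentsOfDegreeLE n t).filter (· ∈ standardExponents G) with hS
  set I := monomialIdeal K G with hI
  set π := (Ideal.Quotient.mkₐ K I).toLinearMap with hπ
  have hker : ∀ x, π x = 0 ↔ ∀ a ∈ x.support, ∃ g ∈ G, g ≤ a := fun x ↦ by
    rw [← MvPolynomial.mem_ideal_span_monomial_image (R := K)]
    exact Ideal.Quotient.eq_zero_iff_mem
  have hmap : (MvPolynomial.restrictTotalDegree (Fin n) K t).map π =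
      (MvPolynomial.restrictSupport K (S : Set (Fin n →₀ ℕ))).map π := by
    refine le_antisymm ?_ (Submodule.map_mono (MvPolynomial.restrictSupport_mono _ ?_))
    · rw [MvPolynomial.restrictTotalDegree, MvPolynomial.restrictSupport_eq_span,
        Submodule.map_span_le]
      rintro _ ⟨a, ha, rfl⟩
      by_cases hst : a ∈ standardExponents G
      · refine Submodule.mem_map_of_mem ?_
        rw [MvPolynomial.monomial_mem_restrictSupport]
        left
        have hat : a.degree ≤ t := ha
        simpa [hS, mem_exponentsOfDegreeLE, hst] using hat
      · have : π (MvPolynomial.monomial a 1) = 0 := by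
          rw [hker]
          simpa [standardExponents, MvPolynomial.support_monomial] using hst
        rw [this]
        exact zero_mem _
    · intro a ha
      have := (Finset.mem_filter.1 (Finset.mem_coe.1 ha)).1
      exact mem_exponentsOfDegreeLE.1 this
  have hinj : Function.Injective
      (π.domRestrict (MvPolynomial.restrictSupport K (S : Set (Fin n →₀ ℕ)))) := by
    rw [injective_iff_map_eq_zero]
    rintro ⟨x, hx⟩ hx0
    have h0 := (hker x).1 hx0
    rw [MvPolynomial.mem_restrictSupport_iff] at hx
    have : x = 0 := by
      rw [← MvPolynomial.support_eq_empty, Finset.eq_empty_iff_forall_notMem]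
      intro a ha
      obtain ⟨g, hg, hga⟩ := h0 a ha
      exact (Finset.mem_filter.1 (Finset.mem_coe.1 (hx ha))).2 g hg hga
    exact Subtype.ext this
  rw [hilbertFunction, ← hπ, hmap, ← LinearMap.range_domRestrict,
    LinearMap.finrank_range_of_inj hinj,
    Module.finrank_eq_card_basis (MvPolynomial.basisRestrictSupport K (S : Set (Fin n →₀ ℕ)))]
  simp

/-! ### The Hilbert polynomial and the degree of a monomial ideal -/

lemma card_finsupp_support_subset_degree_le {n : ℕ} (T : Finset (Fin n)) (m : ℕ) :
    ((Finset.range (m + 1)).biUnion (Finset.finsuppAntidiag T)).card =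
      (m + T.card).choose T.card := by
  classical
  rw [Finset.card_biUnion]
  · induction m with
    | zero => simp [Finset.card_finsuppAntidiag_nat_eq_choose]
    | succ m ih =>
      rw [Finset.sum_range_succ, ih, Finset.card_finsuppAntidiag_nat_eq_choose,
        ← Nat.choose_symm_add, show T.card + (m + 1) - 1 = m + T.card by omega,
        ← Nat.choose_succ_succ, ← Nat.choose_symm_add]
      congr 1
      omega
  · intro i _ j _ hij
    rw [Function.onFun, Finset.disjoint_left]
    intro a ha hb
    rw [Finset.mem_finsuppAntidiag] at ha hb
    exact hij (ha.1.symm.trans hb.1)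

/-- The coordinates at which an exponent vector truncated at `D` reaches `D`; these play the role
of the free variables of a standard pair. -/
def saturated {n : ℕ} (D : ℕ) (b : Fin n → ℕ) : Finset (Fin n) :=
  Finset.univ.filter (fun i ↦ b i = D)

lemma mem_saturated {n D : ℕ} {b : Fin n → ℕ} {i : Fin n} : i ∈ saturated D b ↔ b i = D := by
  simp [saturated]

open Classical in
/-- The standard exponents of the box `[0, D]ⁿ`. When all generators have exponents at most `D`,
an exponent vector is standard if and only if its truncation at `D` is one of these. -/
noncomputable def standardBox {n : ℕ} (G : Set (Fin n →₀ ℕ)) (D : ℕ) : Finset (Fin n → ℕ) :=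
  (Fintype.piFinset (fun _ ↦ Finset.range (D + 1))).filter (fun b ↦ ∀ g ∈ G, ¬ ⇑g ≤ b)

lemma mem_standardBox {n : ℕ} {G : Set (Fin n →₀ ℕ)} {D : ℕ} {b : Fin n → ℕ} :
    b ∈ standardBox G D ↔ (∀ i, b i ≤ D) ∧ ∀ g ∈ G, ¬ ⇑g ≤ b := by
  simp [standardBox]

/-- The exponent vectors of degree at most `t` with a given truncation `b` are the `b + c` with `c`
supported on the saturated coordinates of `b`. -/
lemma card_truncation_fiber {n D t : ℕ} {b : Fin n → ℕ} (hb : ∀ i, b i ≤ D)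
    (ht : ∑ i, b i ≤ t) :
    ((exponentsOfDegreeLE n t).filter (fun a ↦ (fun i ↦ min (a i) D) = b)).card =
      (t - ∑ i, b i + (saturated D b).card).choose (saturated D b).card := by
  classical
  rw [← card_finsupp_support_subset_degree_le]
  set b' : Fin n →₀ ℕ := Finsupp.equivFunOnFinite.symm b with hb'
  have hb'i : ∀ i, b' i = b i := fun i ↦ rfl
  have hdeg : ∀ c : Fin n →₀ ℕ, (b' + c).degree = ∑ i, b i + c.degree := fun c ↦ by
    rw [map_add, Finsupp.degree_eq_sum b']
    rfl
  refine (Finset.card_bij' (fun c _ ↦ b' + c) (fun a _ ↦ a - b') ?_ ?_ ?_ ?_).symm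
  · intro c hc
    simp only [Finset.mem_biUnion, Finset.mem_range, Finset.mem_finsuppAntidiag'] at hc
    obtain ⟨j, hj, hcj, hsupp⟩ := hc
    have hcdeg : c.degree = j := hcj
    rw [Finset.mem_filter, mem_exponentsOfDegreeLE, hdeg]
    refine ⟨by omega, funext fun i ↦ ?_⟩
    have hi := hb i
    by_cases h : b i = D
    · simp [hb'i, h]
    · have : c i = 0 := by
        by_contra hne
        have := hsupp (Finsupp.mem_support_iff.2 hne)
        simp [mem_saturated, h] at this
      simp [hb'i, this, hi]
  · intro a ha
    rw [Finset.mem_filter, mem_exponentsOfDegreeLE] at ha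
    obtain ⟨hat, hab⟩ := ha
    have hle : b' ≤ a := fun i ↦ by
      rw [hb'i, ← hab]
      exact min_le_left _ _
    have hsum := hdeg (a - b')
    rw [add_tsub_cancel_of_le hle] at hsum
    simp only [Finset.mem_biUnion, Finset.mem_range, Finset.mem_finsuppAntidiag']
    refine ⟨(a - b').degree, by omega, rfl, fun i hi ↦ ?_⟩
    have hne : a i - b i ≠ 0 := by simpa [hb'i] using hi
    have := congrFun hab i
    rw [mem_saturated]
    omega
  · intro c _
    exact add_tsub_cancel_left _ _
  · intro a ha
    rw [Finset.mem_filter] at ha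
    refine add_tsub_cancel_of_le fun i ↦ ?_
    rw [hb'i, ← ha.2]
    exact min_le_left _ _

/-- Sorting standard monomials by their truncation at `D` writes the Hilbert polynomial as a sum of
binomial polynomials, one for each standard exponent of the box. -/
lemma isHilbertPolynomial_monomialIdeal (K : Type*) [Field K] {n D : ℕ} {G : Set (Fin n →₀ ℕ)}
    (hG : ∀ g ∈ G, ∀ i, g i ≤ D) :
    IsHilbertPolynomial (monomialIdeal K G)
      (∑ b ∈ standardBox G D, Polynomial.preHilbertPoly ℚ (saturated D b).card (∑ i, b i)) := by
  classical
  filter_upwards [Filter.eventually_ge_atTop (n * D)] with t ht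
  have hmaps : ∀ a ∈ (exponentsOfDegreeLE n t).filter (· ∈ standardExponents G),
      (fun i ↦ min (a i) D) ∈ standardBox G D := by
    intro a ha
    rw [mem_standardBox]
    refine ⟨fun i ↦ min_le_right _ _, fun g hg hle ↦ ?_⟩
    exact (Finset.mem_filter.1 ha).2 g hg fun i ↦ (hle i).trans (min_le_left _ _)
  rw [hilbertFunction_monomialIdeal, Finset.card_eq_sum_card_fiberwise hmaps,
    Polynomial.eval_finsetSum]
  push_cast
  refine Finset.sum_congr rfl fun b hb ↦ ?_
  rw [mem_standardBox] at hb
  have hsum : ∑ i, b i ≤ t := by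
    refine (Finset.sum_le_sum fun i _ ↦ hb.1 i).trans ?_
    simpa using ht
  rw [Polynomial.preHilbertPoly_eq_choose_sub_add _ _ hsum, ← card_truncation_fiber hb.1 hsum,
    Finset.filter_filter]
  congr 2
  refine Finset.filter_congr fun a _ ↦ ⟨fun h ↦ h.2, fun h ↦ ⟨fun g hg hle ↦ ?_, h⟩⟩
  refine hb.2 g hg fun i ↦ ?_
  rw [← h]
  exact le_min (hle i) (hG g hg i)

/-- The degree of a monomial ideal of dimension `s` counts its standard exponents of the box having
`s` saturated coordinates. -/
lemma degree_monomialIdeal (K : Type*) [Field K] {n D s : ℕ} {G : Set (Fin n →₀ ℕ)}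
    (hG : ∀ g ∈ G, ∀ i, g i ≤ D) (hle : ∀ b ∈ standardBox G D, (saturated D b).card ≤ s)
    (hex : ∃ b ∈ standardBox G D, (saturated D b).card = s) :
    degree (monomialIdeal K G) =
      ((standardBox G D).filter (fun b ↦ (saturated D b).card = s)).card := by
  classical
  rw [(isHilbertPolynomial_monomialIdeal K hG).degree_eq]
  set P := ∑ b ∈ standardBox G D, Polynomial.preHilbertPoly ℚ (saturated D b).card (∑ i, b i)
    with hP
  have hcoeff : P.coeff s =
      ((standardBox G D).filter (fun b ↦ (saturated D b).card = s)).card * (s.factorial : ℚ)⁻¹ := by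
    rw [hP, Polynomial.finsetSum_coeff, Finset.card_filter]
    push_cast
    rw [Finset.sum_mul]
    refine Finset.sum_congr rfl fun b hb ↦ ?_
    split_ifs with h
    · rw [← h, Polynomial.coeff_preHilbertPoly_self, one_mul]
    · rw [zero_mul, Polynomial.coeff_eq_zero_of_natDegree_lt]
      rw [Polynomial.natDegree_preHilbertPoly]
      exact lt_of_le_of_ne (hle b hb) h
  have hnat : P.natDegree ≤ s :=
    Polynomial.natDegree_sum_le_of_forall_le _ _ fun b hb ↦ by
      rw [Polynomial.natDegree_preHilbertPoly]
      exact hle b hb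
  have hfac : (s.factorial : ℚ) ≠ 0 := by exact_mod_cast s.factorial_ne_zero
  have hne : P.coeff s ≠ 0 := by
    rw [hcoeff]
    obtain ⟨b, hb, hbs⟩ := hex
    refine mul_ne_zero ?_ (inv_ne_zero hfac)
    exact_mod_cast (Finset.card_pos.2 ⟨b, Finset.mem_filter.2 ⟨hb, hbs⟩⟩).ne'
  have hdeg : P.natDegree = s := le_antisymm hnat (Polynomial.le_natDegree_of_ne_zero hne)
  rw [Polynomial.leadingCoeff, hdeg, hcoeff]
  field_simp

/-! ### Probability estimates for the random generating set -/

lemma unitInterval_coe_toNNReal (p : unitInterval) :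
    ((unitInterval.toNNReal p : NNReal) : ENNReal) = ENNReal.ofReal p := by
  rw [ENNReal.ofReal]
  congr 1
  ext
  simp [p.2.1]

lemma setBernoulli_forall_notMem {ι : Type*} {u : Set ι} (p : unitInterval) (F : Finset ι)
    (hF : ∀ a ∈ F, a ∈ u) :
    setBernoulli u p {G | ∀ a ∈ F, a ∉ G} = ENNReal.ofReal ((1 - p : ℝ) ^ F.card) := by
  have hpre : (fun q : ι → Prop ↦ {i | q i}) ⁻¹' {G | ∀ a ∈ F, a ∉ G} =
      Set.pi (F : Set ι) (fun _ ↦ {False}) := by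
    ext q
    simp
  rw [setBernoulli_apply', hpre, Measure.infinitePi_pi _ (fun _ _ ↦ measurableSet_singleton _)]
  rw [Finset.prod_congr rfl (g := fun _ ↦ ENNReal.ofReal (1 - p : ℝ)), Finset.prod_const,
    ENNReal.ofReal_pow (unitInterval.one_minus_nonneg p)]
  intro a ha
  simp [hF a ha, unitInterval_coe_toNNReal]

lemma setBernoulli_mem_le {ι : Type*} (u : Set ι) (p : unitInterval) (a : ι) :
    setBernoulli u p {G | a ∈ G} ≤ ENNReal.ofReal p := by
  have hpre : (fun q : ι → Prop ↦ {i | q i}) ⁻¹' {G | a ∈ G} =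
      Set.pi (({a} : Finset ι) : Set ι) (fun _ ↦ {True}) := by
    ext q
    simp
  rw [setBernoulli_apply', hpre, Measure.infinitePi_pi _ (fun _ _ ↦ measurableSet_singleton _)]
  by_cases ha : a ∈ u <;> simp [ha, unitInterval_coe_toNNReal]

/-- A union bound over the `∏ (bᵢ + 1)` exponent vectors below `b`. -/
lemma randomGenerators_exists_le (n D : ℕ) (p : unitInterval) (b : Fin n → ℕ) :
    randomGenerators n D p {G | ∃ g ∈ G, ⇑g ≤ b} ≤
      ENNReal.ofReal ((∏ i, ((b i : ℝ) + 1)) * p) := by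
  classical
  set F : Finset (Fin n →₀ ℕ) :=
    (Fintype.piFinset fun i ↦ Finset.range (b i + 1)).map
      Finsupp.equivFunOnFinite.symm.toEmbedding with hF
  have hcard : (F.card : ℝ) = ∏ i, ((b i : ℝ) + 1) := by
    simp [hF]
  have hsub : {G : Set (Fin n →₀ ℕ) | ∃ g ∈ G, ⇑g ≤ b} ⊆ ⋃ a ∈ F, {G | a ∈ G} := by
    rintro G ⟨g, hg, hgb⟩
    simp only [Set.mem_iUnion]
    refine ⟨g, ?_, hg⟩
    rw [hF, Finset.mem_map_equiv, Fintype.mem_piFinset]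
    intro i
    rw [Finset.mem_range, Nat.lt_succ_iff]
    exact hgb i
  calc randomGenerators n D p {G | ∃ g ∈ G, ⇑g ≤ b}
      ≤ ∑ a ∈ F, randomGenerators n D p {G | a ∈ G} :=
        (measure_mono hsub).trans (measure_biUnion_finset_le _ _)
    _ ≤ ∑ _a ∈ F, ENNReal.ofReal p := Finset.sum_le_sum fun a _ ↦ setBernoulli_mem_le _ _ _
    _ = ENNReal.ofReal ((∏ i, ((b i : ℝ) + 1)) * p) := by
        rw [Finset.sum_const, nsmul_eq_mul, ← hcard, ENNReal.ofReal_mul (Nat.cast_nonneg _),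
          ENNReal.ofReal_natCast]

/-- Below `b` there are at least `∏ (bᵢ + 1) / nⁿ - 1` admissible generators: the nonzero vectors
whose entries are moreover at most `D / n`, which keeps the degree below `D`. -/
lemma randomGenerators_forall_not_le {n D : ℕ} (hn : 1 ≤ n) (p : unitInterval) {b : Fin n → ℕ}
    (hb : ∀ i, b i < D) :
    randomGenerators n D p {G | ∀ g ∈ G, ¬ ⇑g ≤ b} ≤
      ENNReal.ofReal (Real.exp (1 - p * ((∏ i, ((b i : ℝ) + 1)) / (n : ℝ) ^ n))) := by
  classical
  set F₀ : Finset (Fin n →₀ ℕ) :=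
    (Fintype.piFinset fun i ↦ Finset.range (min (b i) (D / n) + 1)).map
      Finsupp.equivFunOnFinite.symm.toEmbedding with hF₀
  have hmem : ∀ a ∈ F₀, ∀ i, a i ≤ b i ∧ a i ≤ D / n := by
    intro a ha i
    rw [hF₀, Finset.mem_map_equiv, Fintype.mem_piFinset] at ha
    have := Finset.mem_range.1 (ha i)
    rw [Nat.lt_succ_iff, le_min_iff] at this
    exact this
  have hcard : (∏ i, ((b i : ℝ) + 1)) / (n : ℝ) ^ n ≤ F₀.card := by
    have hn0 : (0 : ℝ) < n := by exact_mod_cast hn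
    have : (n : ℝ) ^ n = ∏ _i : Fin n, (n : ℝ) := by simp
    rw [this, ← Finset.prod_div_distrib, hF₀, Finset.card_map, Fintype.card_piFinset]
    push_cast
    refine Finset.prod_le_prod (fun i _ ↦ by positivity) fun i _ ↦ ?_
    rw [div_le_iff₀ hn0, Finset.card_range]
    have h1 : b i + 1 ≤ (min (b i) (D / n) + 1) * n := by
      rcases min_cases (b i) (D / n) with ⟨h, -⟩ | ⟨h, -⟩ <;> rw [h]
      · exact Nat.le_mul_of_pos_right _ hn
      · have := Nat.lt_mul_div_succ D hn
        have := hb i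
        nlinarith
    exact_mod_cast h1
  set F := F₀.erase 0 with hF
  have hFcard : (∏ i, ((b i : ℝ) + 1)) / (n : ℝ) ^ n - 1 ≤ F.card := by
    have : F₀.card ≤ F.card + 1 := by
      rw [hF]
      have := Finset.pred_card_le_card_erase (s := F₀) (a := 0)
      omega
    have : (F₀.card : ℝ) ≤ F.card + 1 := by exact_mod_cast this
    linarith
  have hFu : ∀ a ∈ F, a ∈ {a : Fin n →₀ ℕ | 0 < a.degree ∧ a.degree ≤ D} := by
    intro a ha
    rw [hF, Finset.mem_erase] at ha
    refine ⟨Nat.pos_of_ne_zero fun h ↦ ha.1 ((Finsupp.degree_eq_zero_iff a).1 h), ?_⟩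
    rw [Finsupp.degree_eq_sum]
    calc ∑ i, a i ≤ ∑ _i : Fin n, D / n := Finset.sum_le_sum fun i _ ↦ (hmem a ha.2 i).2
      _ = n * (D / n) := by simp
      _ ≤ D := Nat.mul_div_le D n
  have hsub : {G : Set (Fin n →₀ ℕ) | ∀ g ∈ G, ¬ ⇑g ≤ b} ⊆ {G | ∀ a ∈ F, a ∉ G} :=
    fun G hG a ha haG ↦ hG a haG fun i ↦ (hmem a (Finset.mem_of_mem_erase ha) i).1
  have hp0 : (0 : ℝ) ≤ p := p.2.1
  have hp1 : (p : ℝ) ≤ 1 := p.2.2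
  refine (measure_mono hsub).trans ?_
  rw [randomGenerators, setBernoulli_forall_notMem p F hFu]
  refine ENNReal.ofReal_le_ofReal ?_
  calc (1 - p : ℝ) ^ F.card ≤ Real.exp (-p) ^ F.card :=
        pow_le_pow_left₀ (by linarith) (Real.one_sub_le_exp_neg _) _
    _ = Real.exp (-(p * F.card)) := by rw [← Real.exp_nat_mul]; ring_nf
    _ ≤ _ := by
        rw [Real.exp_le_exp]
        nlinarith

/-- A union bound over `[0, D)ⁿ`: when `p * y` is at least a positive power of `D`, it is unlikely
that some `b` with more than `y` vectors below it dominates no generator. -/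
lemma randomGenerators_exists_forall_not_le {n D : ℕ} (hn : 1 ≤ n) (p : unitInterval) (y : ℝ) :
    randomGenerators n D p {G | ∃ b : Fin n → ℕ, (∀ i, b i < D) ∧ y < ∏ i, ((b i : ℝ) + 1) ∧
        ∀ g ∈ G, ¬ ⇑g ≤ b} ≤
      ENNReal.ofReal ((D : ℝ) ^ n * Real.exp (1 - p * (y / (n : ℝ) ^ n))) := by
  classical
  set F := (Fintype.piFinset fun _ : Fin n ↦ Finset.range D).filter
    (fun b ↦ y < ∏ i, ((b i : ℝ) + 1)) with hF
  have hcard : (F.card : ℝ) ≤ (D : ℝ) ^ n := by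
    have := Finset.card_filter_le (Fintype.piFinset fun _ : Fin n ↦ Finset.range D)
      (fun b ↦ y < ∏ i, ((b i : ℝ) + 1))
    rw [← hF] at this
    simp only [Fintype.card_piFinset, Finset.card_range, Finset.prod_const, Finset.card_univ,
      Fintype.card_fin] at this
    exact_mod_cast this
  have hsub : {G : Set (Fin n →₀ ℕ) | ∃ b : Fin n → ℕ, (∀ i, b i < D) ∧
      y < ∏ i, ((b i : ℝ) + 1) ∧ ∀ g ∈ G, ¬ ⇑g ≤ b} ⊆ ⋃ b ∈ F, {G | ∀ g ∈ G, ¬ ⇑g ≤ b} := by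
    rintro G ⟨b, hb, hby, hG⟩
    simp only [Set.mem_iUnion]
    refine ⟨b, ?_, hG⟩
    simpa [hF, hby] using hb
  have hp0 : (0 : ℝ) ≤ p := p.2.1
  refine (measure_mono hsub).trans ((measure_biUnion_finset_le _ _).trans ?_)
  calc ∑ b ∈ F, randomGenerators n D p {G | ∀ g ∈ G, ¬ ⇑g ≤ b}
      ≤ ∑ _b ∈ F, ENNReal.ofReal (Real.exp (1 - p * (y / (n : ℝ) ^ n))) := by
        refine Finset.sum_le_sum fun b hb ↦ ?_
        rw [hF, Finset.mem_filter, Fintype.mem_piFinset] at hb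
        refine (randomGenerators_forall_not_le hn p fun i ↦ Finset.mem_range.1 (hb.1 i)).trans
          (ENNReal.ofReal_le_ofReal ?_)
        have := hb.2.le
        gcongr
    _ = ENNReal.ofReal (F.card * Real.exp (1 - p * (y / (n : ℝ) ^ n))) := by
        rw [Finset.sum_const, nsmul_eq_mul, ENNReal.ofReal_mul (Nat.cast_nonneg _),
          ENNReal.ofReal_natCast]
    _ ≤ _ := ENNReal.ofReal_le_ofReal (by gcongr)

/-! ### Counting lattice points under a hyperbola -/

lemma sum_range_inv_le_one_add_log (D : ℕ) :
    ∑ b ∈ Finset.range D, ((b : ℝ) + 1)⁻¹ ≤ 1 + Real.log D := by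
  refine le_trans (le_of_eq ?_) (harmonic_le_one_add_log D)
  simp [harmonic]

/-- Markov's inequality for the counting measure and a product weight. -/
lemma card_filter_one_le_prod {n : ℕ} (S : Finset ℕ) (w : ℕ → ℝ) (hw : ∀ b ∈ S, 0 ≤ w b)
    (y : ℝ) (hy : 0 ≤ y) :
    (((Fintype.piFinset fun _ : Fin n ↦ S).filter (fun b ↦ 1 ≤ y * ∏ i, w (b i))).card : ℝ) ≤
      y * (∑ b ∈ S, w b) ^ n := by
  classical
  have hnn : ∀ b ∈ Fintype.piFinset fun _ : Fin n ↦ S, 0 ≤ y * ∏ i, w (b i) := fun b hb ↦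
    mul_nonneg hy (Finset.prod_nonneg fun i _ ↦ hw _ (Fintype.mem_piFinset.1 hb i))
  calc (((Fintype.piFinset fun _ : Fin n ↦ S).filter (fun b ↦ 1 ≤ y * ∏ i, w (b i))).card : ℝ)
      = ∑ b ∈ (Fintype.piFinset fun _ : Fin n ↦ S).filter (fun b ↦ 1 ≤ y * ∏ i, w (b i)), 1 := by
        simp
    _ ≤ ∑ b ∈ (Fintype.piFinset fun _ : Fin n ↦ S).filter (fun b ↦ 1 ≤ y * ∏ i, w (b i)),
          y * ∏ i, w (b i) := Finset.sum_le_sum fun b hb ↦ (Finset.mem_filter.1 hb).2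
    _ ≤ ∑ b ∈ Fintype.piFinset fun _ : Fin n ↦ S, y * ∏ i, w (b i) :=
        Finset.sum_le_sum_of_subset_of_nonneg (Finset.filter_subset _ _) fun b hb _ ↦ hnn b hb
    _ = y * (∑ b ∈ S, w b) ^ n := by
        rw [← Finset.mul_sum, ← Finset.prod_univ_sum]
        simp

lemma le_of_prod_add_one_le {m : ℕ} {x : ℝ} {a : Fin m → ℕ} (h : ∏ i, ((a i : ℝ) + 1) ≤ x)
    (i : Fin m) : (a i : ℝ) + 1 ≤ x := by
  classical
  refine le_trans ?_ h
  rw [← Finset.mul_prod_erase _ _ (Finset.mem_univ i)]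
  refine le_mul_of_one_le_right (by positivity) ?_
  rw [← Finset.prod_const_one (s := Finset.univ.erase i)]
  exact Finset.prod_le_prod (fun _ _ ↦ zero_le_one) fun j _ ↦ by simp

lemma Z_le {m D : ℕ} {x : ℝ} (hx0 : 0 ≤ x) (hxD : x ≤ D) :
    (Z m x : ℝ) ≤ x * (1 + Real.log D) ^ m := by
  classical
  have hsub : {a : Fin m → ℕ | ∏ i, ((a i : ℝ) + 1) ≤ x} ⊆
      ((Fintype.piFinset fun _ : Fin m ↦ Finset.range D).filter
        (fun b ↦ 1 ≤ x * ∏ i, (fun c : ℕ ↦ ((c : ℝ) + 1)⁻¹) (b i)) : Set (Fin m → ℕ)) := by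
    intro a ha
    rw [Finset.mem_coe, Finset.mem_filter, Fintype.mem_piFinset]
    refine ⟨fun i ↦ ?_, ?_⟩
    · rw [Finset.mem_range]
      have : (a i : ℝ) + 1 ≤ D := (le_of_prod_add_one_le ha i).trans hxD
      exact_mod_cast this
    · have hpos : 0 < ∏ i, ((a i : ℝ) + 1) := Finset.prod_pos fun i _ ↦ by positivity
      rw [Finset.prod_inv_distrib, ← div_eq_mul_inv, one_le_div hpos]
      exact ha
  have h1 := Set.ncard_le_ncard hsub (Finset.finite_toSet _)
  rw [Set.ncard_coe_finset] at h1
  have h2 := card_filter_one_le_prod (n := m) (Finset.range D) (fun c : ℕ ↦ ((c : ℝ) + 1)⁻¹)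
    (fun b _ ↦ by positivity) x hx0
  refine le_trans (Nat.cast_le.2 h1) (h2.trans ?_)
  have := sum_range_inv_le_one_add_log D
  have h0 : 0 ≤ ∑ b ∈ Finset.range D, ((b : ℝ) + 1)⁻¹ := Finset.sum_nonneg fun b _ ↦ by positivity
  gcongr

lemma sub_one_lt_Z {m : ℕ} (hm : 1 ≤ m) {x : ℝ} (hx : 0 ≤ x) : x - 1 < Z m x := by
  classical
  have hfin : {a : Fin m → ℕ | ∏ i, ((a i : ℝ) + 1) ≤ x}.Finite := by
    refine (Fintype.piFinset fun _ : Fin m ↦ Finset.range (⌊x⌋₊ + 1)).finite_toSet.subset ?_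
    intro a ha
    rw [Finset.mem_coe, Fintype.mem_piFinset]
    intro i
    rw [Finset.mem_range, Nat.lt_succ_iff]
    refine Nat.le_floor ?_
    have := le_of_prod_add_one_le ha i
    linarith
  let i₀ : Fin m := ⟨0, hm⟩
  have hsub : (((Finset.range ⌊x⌋₊).image (Pi.single i₀) : Finset (Fin m → ℕ)) :
      Set (Fin m → ℕ)) ⊆
      {a : Fin m → ℕ | ∏ i, ((a i : ℝ) + 1) ≤ x} := by
    intro a ha
    simp only [Finset.coe_image, Set.mem_image, Finset.coe_range, Set.mem_Iio] at ha
    obtain ⟨c, hc, rfl⟩ := ha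
    rw [Set.mem_ofPred_eq, Finset.prod_eq_single i₀]
    · rw [Pi.single_eq_same]
      have : ((c + 1 : ℕ) : ℝ) ≤ x := (Nat.cast_le.2 hc).trans (Nat.floor_le hx)
      exact_mod_cast this
    · intro j _ hj
      simp [hj]
    · simp
  have h1 := Set.ncard_le_ncard hsub hfin
  rw [Set.ncard_coe_finset, Finset.card_image_of_injective _ (Pi.single_injective i₀),
    Finset.card_range] at h1
  have h2 : (⌊x⌋₊ : ℝ) ≤ Z m x := Nat.cast_le.2 h1
  linarith [Nat.lt_floor_add_one x]

/-! ### Bounds for the degree -/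

/-- Decreasing the saturated coordinates of a standard vector by one gives a standard vector of
`[0, D)ⁿ`; this bounds the product of its entries. -/
lemma prod_le_of_mem_standardBox {n D : ℕ} (hD : 1 ≤ D) {G : Set (Fin n →₀ ℕ)} {y : ℝ}
    (hG : ∀ b : Fin n → ℕ, (∀ i, b i < D) → y < ∏ i, ((b i : ℝ) + 1) → ∃ g ∈ G, ⇑g ≤ b)
    {b : Fin n → ℕ} (hb : b ∈ standardBox G D) :
    (D : ℝ) ^ (saturated D b).card * ∏ i ∈ (saturated D b)ᶜ, ((b i : ℝ) + 1) ≤ y := by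
  rw [mem_standardBox] at hb
  by_contra! hlt
  have hprod : ∏ i, (((min (b i) (D - 1) : ℕ) : ℝ) + 1) =
      (D : ℝ) ^ (saturated D b).card * ∏ i ∈ (saturated D b)ᶜ, ((b i : ℝ) + 1) := by
    rw [← Finset.prod_mul_prod_compl (saturated D b), ← Finset.prod_const]
    congr 1
    · refine Finset.prod_congr rfl fun i hi ↦ ?_
      have : b i = D := mem_saturated.1 hi
      have : min (b i) (D - 1) + 1 = D := by omega
      exact_mod_cast this
    · refine Finset.prod_congr rfl fun i hi ↦ ?_
      have h1 : b i ≠ D := by simpa [mem_saturated] using hi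
      have h2 := hb.1 i
      rw [min_eq_left (by omega)]
  obtain ⟨g, hg, hgb⟩ := hG (fun i ↦ min (b i) (D - 1)) (fun i ↦ by
    have := min_le_right (b i) (D - 1)
    omega) (by rw [hprod]; exact hlt)
  exact hb.2 g hg fun i ↦ (hgb i).trans (min_le_left _ _)

lemma card_saturated_le {n D s : ℕ} (hD : 1 ≤ D) {G : Set (Fin n →₀ ℕ)} {y : ℝ}
    (hG : ∀ b : Fin n → ℕ, (∀ i, b i < D) → y < ∏ i, ((b i : ℝ) + 1) → ∃ g ∈ G, ⇑g ≤ b)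
    (hy : y < (D : ℝ) ^ (s + 1)) {b : Fin n → ℕ} (hb : b ∈ standardBox G D) :
    (saturated D b).card ≤ s := by
  by_contra! hlt
  have h1 : (1 : ℝ) ≤ D := by exact_mod_cast hD
  have h2 := prod_le_of_mem_standardBox hD hG hb
  have h3 : (D : ℝ) ^ (s + 1) ≤ (D : ℝ) ^ (saturated D b).card := pow_le_pow_right₀ h1 hlt
  have h4 : (1 : ℝ) ≤ ∏ i ∈ (saturated D b)ᶜ, ((b i : ℝ) + 1) := by
    rw [← Finset.prod_const_one (s := (saturated D b)ᶜ)]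
    exact Finset.prod_le_prod (fun _ _ ↦ zero_le_one) fun j _ ↦ by simp
  have h5 := le_mul_of_one_le_right (by positivity : (0 : ℝ) ≤ (D : ℝ) ^ (saturated D b).card) h4
  linarith

/-- The weight `1 / (c + 1)`, with weight `1` for the saturated value `D`, turns the bound on the
products of entries into a bound on the number of standard vectors. -/
lemma card_filter_saturated_le {n D s : ℕ} (hD : 1 ≤ D) {G : Set (Fin n →₀ ℕ)} {y : ℝ}
    (hy : 0 ≤ y)
    (hG : ∀ b : Fin n → ℕ, (∀ i, b i < D) → (D : ℝ) ^ s * y < ∏ i, ((b i : ℝ) + 1) →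
      ∃ g ∈ G, ⇑g ≤ b) :
    (((standardBox G D).filter (fun b ↦ (saturated D b).card = s)).card : ℝ) ≤
      y * (2 + Real.log D) ^ n := by
  classical
  set w : ℕ → ℝ := fun c ↦ if c = D then 1 else ((c : ℝ) + 1)⁻¹ with hw
  have hw0 : ∀ c, 0 ≤ w c := fun c ↦ by
    rw [hw]
    dsimp only
    split_ifs <;> positivity
  have hDpos : (0 : ℝ) < D := by exact_mod_cast hD
  have hsub : (standardBox G D).filter (fun b ↦ (saturated D b).card = s) ⊆
      (Fintype.piFinset fun _ : Fin n ↦ Finset.range (D + 1)).filter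
        (fun b ↦ 1 ≤ y * ∏ i, w (b i)) := by
    intro b hb
    rw [Finset.mem_filter] at hb
    have h1 := prod_le_of_mem_standardBox hD hG hb.1
    rw [hb.2] at h1
    have h2 : ∏ i ∈ (saturated D b)ᶜ, ((b i : ℝ) + 1) ≤ y :=
      le_of_mul_le_mul_left h1 (by positivity)
    have h3 : ∏ i, w (b i) = (∏ i ∈ (saturated D b)ᶜ, ((b i : ℝ) + 1))⁻¹ := by
      rw [← Finset.prod_mul_prod_compl (saturated D b), Finset.prod_eq_one, one_mul,
        ← Finset.prod_inv_distrib]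
      · refine Finset.prod_congr rfl fun i hi ↦ ?_
        have : b i ≠ D := by simpa [saturated] using hi
        simp [hw, this]
      · intro i hi
        have : b i = D := mem_saturated.1 hi
        simp [hw, this]
    rw [Finset.mem_filter]
    refine ⟨?_, ?_⟩
    · rw [Fintype.mem_piFinset]
      intro i
      rw [Finset.mem_range, Nat.lt_succ_iff]
      exact (mem_standardBox.1 hb.1).1 i
    · rw [h3, ← div_eq_mul_inv, one_le_div (Finset.prod_pos fun i _ ↦ by positivity)]
      exact h2
  have hsum : ∑ c ∈ Finset.range (D + 1), w c ≤ 2 + Real.log D := by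
    rw [Finset.sum_range_succ]
    have h1 : ∑ c ∈ Finset.range D, w c = ∑ c ∈ Finset.range D, ((c : ℝ) + 1)⁻¹ :=
      Finset.sum_congr rfl fun c hc ↦ by simp [hw, (Finset.mem_range.1 hc).ne]
    have h2 := sum_range_inv_le_one_add_log D
    have h3 : w D = 1 := by simp [hw]
    rw [h1, h3]
    linarith
  have h0 : 0 ≤ ∑ c ∈ Finset.range (D + 1), w c := Finset.sum_nonneg fun c _ ↦ hw0 c
  refine le_trans (by exact_mod_cast Finset.card_le_card hsub)
    ((card_filter_one_le_prod _ w (fun c _ ↦ hw0 c) y hy).trans ?_)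
  gcongr

/-- The exponent vector with entry `D` on `T`, entry `c` at `j`, and zero elsewhere. -/
def spike {n : ℕ} (D : ℕ) (T : Finset (Fin n)) (j : Fin n) (c : ℕ) : Fin n → ℕ :=
  fun i ↦ if i ∈ T then D else if i = j then c else 0

lemma saturated_spike {n D c : ℕ} {T : Finset (Fin n)} {j : Fin n} (hc : c < D) :
    saturated D (spike D T j c) = T := by
  ext i
  rw [mem_saturated, spike]
  split_ifs with h1 h2
  · simp [h1]
  · simp [h1, hc.ne]
  · simp only [h1, iff_false]
    omega

lemma prod_spike_add_one {n D c : ℕ} {T : Finset (Fin n)} {j : Fin n} (hj : j ∉ T) :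
    ∏ i, ((spike D T j c i : ℝ) + 1) = (D + 1 : ℝ) ^ T.card * (c + 1) := by
  rw [← Finset.prod_mul_prod_compl T, Finset.prod_eq_pow_card (b := (D + 1 : ℝ)),
    Finset.prod_eq_single_of_mem j (Finset.mem_compl.2 hj)]
  · simp [spike, hj]
  · intro i hi hij
    simp [spike, Finset.mem_compl.1 hi, hij]
  · intro i hi
    simp [spike, hi]

/-- If the vector `spike D T j X` is standard, then so are the vectors `spike D T j c` with
`c ≤ X`. -/
lemma le_card_filter_saturated {n D X : ℕ} {G : Set (Fin n →₀ ℕ)} {T : Finset (Fin n)} {j : Fin n}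
    (hj : j ∉ T) (hX : X < D) (hG : ∀ g ∈ G, ¬ ⇑g ≤ spike D T j X) :
    X + 1 ≤ ((standardBox G D).filter (fun b ↦ (saturated D b).card = T.card)).card := by
  classical
  have hinj : Function.Injective (spike D T j) := fun c d h ↦ by
    simpa [spike, hj] using congrFun h j
  rw [← Finset.card_range (X + 1), ← Finset.card_image_of_injective _ hinj]
  refine Finset.card_le_card fun b hb ↦ ?_
  obtain ⟨c, hc, rfl⟩ := Finset.mem_image.1 hb
  have hcX : c ≤ X := Nat.lt_succ_iff.1 (Finset.mem_range.1 hc)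
  rw [Finset.mem_filter, mem_standardBox, saturated_spike (hcX.trans_lt hX)]
  refine ⟨⟨fun i ↦ ?_, fun g hg hle ↦ hG g hg (hle.trans fun i ↦ ?_)⟩, rfl⟩
  · simp only [spike]
    split_ifs <;> omega
  · simp only [spike]
    split_ifs <;> omega

/-- Deterministic two-sided bound for the degree, given that no generator lies below
`spike D T j X` and that every vector of `[0, D)ⁿ` with large product lies above a generator. -/
lemma degree_monomialIdeal_bounds (K : Type*) [Field K] {n D X : ℕ} {G : Set (Fin n →₀ ℕ)}
    {T : Finset (Fin n)} {j : Fin n} {y : ℝ} (hy : 0 ≤ y) (hyD : y < D)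
    (hdeg : ∀ g ∈ G, g.degree ≤ D) (hj : j ∉ T) (hX : X < D)
    (hlow : ∀ g ∈ G, ¬ ⇑g ≤ spike D T j X)
    (hup : ∀ b : Fin n → ℕ, (∀ i, b i < D) → (D : ℝ) ^ T.card * y < ∏ i, ((b i : ℝ) + 1) →
      ∃ g ∈ G, ⇑g ≤ b) :
    (X + 1 : ℝ) ≤ degree (monomialIdeal K G) ∧
      (degree (monomialIdeal K G) : ℝ) ≤ y * (2 + Real.log D) ^ n := by
  have hD : 1 ≤ D := by omega
  have hDpos : (0 : ℝ) < D := by exact_mod_cast hD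
  have hlower := le_card_filter_saturated hj hX hlow
  have hle : ∀ b ∈ standardBox G D, (saturated D b).card ≤ T.card := fun b hb ↦
    card_saturated_le hD hup (by rw [pow_succ]; gcongr) hb
  have hex : ∃ b ∈ standardBox G D, (saturated D b).card = T.card := by
    obtain ⟨b, hb⟩ := Finset.card_pos.1 (Nat.lt_of_lt_of_le (Nat.succ_pos X) hlower)
    exact ⟨b, Finset.mem_filter.1 hb⟩
  rw [degree_monomialIdeal K
    (fun g hg i ↦ (Finsupp.le_degree i g).trans (hdeg g hg)) hle hex]
  refine ⟨?_, ?_⟩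
  · exact_mod_cast hlower
  · exact_mod_cast card_filter_saturated_le hD hy hup

/-! ### Asymptotics -/

lemma eventually_two_mul_log_pow_le (n : ℕ) {δ : ℝ} (hδ : 0 < δ) :
    ∀ᶠ D : ℕ in atTop, 2 * (2 + Real.log D) ^ n ≤ (D : ℝ) ^ δ := by
  set r : ℝ := δ / (n + 1) with hr
  have hr0 : 0 < r := by positivity
  have hlog : ∀ᶠ x : ℝ in atTop, 2 + Real.log x ≤ x ^ r := by
    have h1 := (isLittleO_log_rpow_atTop hr0).bound (show (0 : ℝ) < 1 / 2 by norm_num)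
    have h2 := (tendsto_rpow_atTop hr0).eventually_ge_atTop 4
    filter_upwards [h1, h2, eventually_ge_atTop 1] with x h1 h2 h3
    have h4 : 0 ≤ x ^ r := by positivity
    rw [Real.norm_of_nonneg (Real.log_nonneg h3), Real.norm_of_nonneg h4] at h1
    linarith
  filter_upwards [tendsto_natCast_atTop_atTop.eventually hlog, eventually_ge_atTop 1] with D h1 h2
  have hD : (1 : ℝ) ≤ D := by exact_mod_cast h2
  have hl : 0 ≤ Real.log D := Real.log_nonneg hD
  calc 2 * (2 + Real.log D) ^ n ≤ (2 + Real.log D) * (2 + Real.log D) ^ n := by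
        gcongr
        linarith
    _ = (2 + Real.log D) ^ (n + 1) := by ring
    _ ≤ ((D : ℝ) ^ r) ^ (n + 1) := by gcongr
    _ = (D : ℝ) ^ δ := by
        rw [← Real.rpow_natCast, ← Real.rpow_mul (by positivity)]
        congr 1
        rw [hr]
        push_cast
        field_simp

lemma tendsto_pow_mul_exp_one_sub_rpow (n : ℕ) {e c : ℝ} (he : 0 < e) (hc : 0 < c) :
    Tendsto (fun D : ℕ ↦ (D : ℝ) ^ n * Real.exp (1 - (D : ℝ) ^ e / c)) atTop (𝓝 0) := by
  have h1 := tendsto_rpow_mul_exp_neg_mul_atTop_nhds_zero (n / e) c⁻¹ (inv_pos.2 hc)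
  have h2 := (h1.comp ((tendsto_rpow_atTop he).comp tendsto_natCast_atTop_atTop)).const_mul
    (Real.exp 1)
  rw [mul_zero] at h2
  refine h2.congr fun D ↦ ?_
  have hD : (0 : ℝ) ≤ D := Nat.cast_nonneg D
  simp only [Function.comp]
  rw [← Real.rpow_mul hD, mul_div_cancel₀ _ he.ne', Real.rpow_natCast, sub_eq_add_neg, Real.exp_add,
    show -((D : ℝ) ^ e / c) = -c⁻¹ * (D : ℝ) ^ e by ring]
  ring

/-- The degree is `D ^ (k - s + o(1))` with high probability. -/
lemma tendsto_randomGenerators_degree_bounds (K : Type*) [Field K] {n s : ℕ} {k e : ℝ}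
    (hsn : s < n) (he : 0 < e) (hek : e ≤ k - s) (hek1 : k - s + e < 1)
    (p : ℕ → unitInterval) (hp : ∀ D : ℕ, 1 ≤ D → (p D : ℝ) = (D : ℝ) ^ (-k)) :
    Tendsto (fun D : ℕ ↦ randomGenerators n D (p D)
      {G : Set (Fin n →₀ ℕ) | (D : ℝ) ^ (k - s - e) ≤ degree (monomialIdeal K G) ∧
        (degree (monomialIdeal K G) : ℝ) ≤ (D : ℝ) ^ (k - s + e) * (2 + Real.log D) ^ n})
      atTop (𝓝 1) := by
  have hn : 1 ≤ n := by omega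
  obtain ⟨T, -, hT⟩ : ∃ T ⊆ (Finset.univ : Finset (Fin n)), T.card = s :=
    Finset.exists_subset_card_eq (by simpa using hsn.le)
  obtain ⟨j, hj⟩ : ∃ j, j ∉ T := by
    by_contra! h
    have : T = Finset.univ := Finset.eq_univ_iff_forall.2 h
    rw [this, Finset.card_univ, Fintype.card_fin] at hT
    omega
  have hb1 : Tendsto (fun D : ℕ ↦ ENNReal.ofReal (2 ^ (s + 1) * (D : ℝ) ^ (-e))) atTop (𝓝 0) := by
    rw [← ENNReal.ofReal_zero]
    refine ENNReal.tendsto_ofReal ?_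
    have := ((tendsto_rpow_neg_atTop he).comp tendsto_natCast_atTop_atTop).const_mul
      ((2 : ℝ) ^ (s + 1))
    rwa [mul_zero] at this
  have hb2 : Tendsto (fun D : ℕ ↦
      ENNReal.ofReal ((D : ℝ) ^ n * Real.exp (1 - (D : ℝ) ^ e / (n : ℝ) ^ n))) atTop (𝓝 0) := by
    rw [← ENNReal.ofReal_zero]
    exact ENNReal.tendsto_ofReal (tendsto_pow_mul_exp_one_sub_rpow n he (by positivity))
  have hb : Tendsto (fun D : ℕ ↦ 1 - (ENNReal.ofReal (2 ^ (s + 1) * (D : ℝ) ^ (-e)) +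
      ENNReal.ofReal ((D : ℝ) ^ n * Real.exp (1 - (D : ℝ) ^ e / (n : ℝ) ^ n)))) atTop (𝓝 1) := by
    have := ENNReal.Tendsto.sub (tendsto_const_nhds (x := (1 : ENNReal)) (f := atTop))
      (hb1.add hb2) (Or.inl ENNReal.one_ne_top)
    simpa using this
  refine tendsto_of_tendsto_of_tendsto_of_le_of_le' hb tendsto_const_nhds ?_
    (Eventually.of_forall fun D ↦ by rw [randomGenerators]; exact prob_le_one)
  filter_upwards [eventually_ge_atTop 2] with D hD2
  have hD : 1 < (D : ℝ) := by exact_mod_cast hD2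
  have hD0 : 0 < (D : ℝ) := by linarith
  set x := (D : ℝ) ^ (k - s - e) with hx
  set y := (D : ℝ) ^ (k - s + e) with hy
  have hx1 : 1 ≤ x := Real.one_le_rpow hD.le (by linarith)
  have hxD : x ≤ D := by
    conv_rhs => rw [← Real.rpow_one (D : ℝ)]
    exact Real.rpow_le_rpow_of_exponent_le hD.le (by linarith)
  have hyD : y < D := by
    conv_rhs => rw [← Real.rpow_one (D : ℝ)]
    exact Real.rpow_lt_rpow_of_exponent_lt hD hek1
  have hceil1 : 1 ≤ ⌈x⌉₊ := Nat.one_le_ceil_iff.2 (by linarith)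
  have hceilD : ⌈x⌉₊ ≤ D := Nat.ceil_le.2 hxD
  set X := ⌈x⌉₊ - 1 with hXdef
  have hX1 : X + 1 = ⌈x⌉₊ := by omega
  have hXr : (X : ℝ) + 1 = ⌈x⌉₊ := by exact_mod_cast hX1
  have hXx : (X : ℝ) + 1 ≤ 2 * x := by
    rw [hXr]
    linarith [Nat.ceil_lt_add_one (zero_le_one.trans hx1)]
  set E := {G : Set (Fin n →₀ ℕ) | x ≤ degree (monomialIdeal K G) ∧
        (degree (monomialIdeal K G) : ℝ) ≤ y * (2 + Real.log D) ^ n} with hE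
  -- The two exceptional events: a generator lies below `spike D T j X`, or some vector with a large
  -- product of entries lies above no generator.
  set B₁ := {G : Set (Fin n →₀ ℕ) | ∃ g ∈ G, ⇑g ≤ spike D T j X} with hB₁
  set B₂ := {G : Set (Fin n →₀ ℕ) | ∃ b : Fin n → ℕ, (∀ i, b i < D) ∧
    (D : ℝ) ^ s * y < ∏ i, ((b i : ℝ) + 1) ∧ ∀ g ∈ G, ¬ ⇑g ≤ b} with hB₂
  set μ := randomGenerators n D (p D) with hμ
  have hprob : μ Set.univ = 1 := by
    rw [hμ, randomGenerators]
    exact measure_univ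
  have hae : ∀ᵐ G ∂μ, G ⊆ {a : Fin n →₀ ℕ | 0 < a.degree ∧ a.degree ≤ D} :=
    setBernoulli_ae_subset
  have hm1 : μ B₁ ≤ ENNReal.ofReal (2 ^ (s + 1) * (D : ℝ) ^ (-e)) := by
    refine (randomGenerators_exists_le n D (p D) _).trans (ENNReal.ofReal_le_ofReal ?_)
    rw [prod_spike_add_one hj, hT, hp D (by omega)]
    calc ((D : ℝ) + 1) ^ s * (X + 1) * (D : ℝ) ^ (-k)
        ≤ (2 * D) ^ s * (2 * x) * (D : ℝ) ^ (-k) := by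
          gcongr
          linarith
      _ = 2 ^ (s + 1) * ((D : ℝ) ^ (s : ℝ) * (D : ℝ) ^ (k - s - e) * (D : ℝ) ^ (-k)) := by
          rw [Real.rpow_natCast, ← hx]
          ring
      _ = 2 ^ (s + 1) * (D : ℝ) ^ (-e) := by
          rw [← Real.rpow_add hD0, ← Real.rpow_add hD0]
          ring_nf
  have hm2 : μ B₂ ≤
      ENNReal.ofReal ((D : ℝ) ^ n * Real.exp (1 - (D : ℝ) ^ e / (n : ℝ) ^ n)) := by
    refine (randomGenerators_exists_forall_not_le hn (p D) _).trans (le_of_eq ?_)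
    have : (D : ℝ) ^ (-k) * ((D : ℝ) ^ s * y) = (D : ℝ) ^ e := by
      rw [← Real.rpow_natCast, ← Real.rpow_add hD0, ← Real.rpow_add hD0]
      ring_nf
    rw [hp D (by omega), ← mul_div_assoc, this]
  -- No measurability of `E` is needed: its complement is covered by `B₁ ∪ B₂` up to a null set.
  have hcover : μ Eᶜ ≤ μ (B₁ ∪ B₂) := by
    refine measure_mono_ae ?_
    filter_upwards [hae] with G hG hGE
    by_contra hB
    have hB' : ¬ (G ∈ B₁ ∨ G ∈ B₂) := hB
    rw [not_or] at hB'
    refine hGE ?_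
    have hlow : ∀ g ∈ G, ¬ ⇑g ≤ spike D T j X := fun g hg hle ↦ hB'.1 ⟨g, hg, hle⟩
    have hup : ∀ b : Fin n → ℕ, (∀ i, b i < D) → (D : ℝ) ^ T.card * y < ∏ i, ((b i : ℝ) + 1) →
        ∃ g ∈ G, ⇑g ≤ b := by
      intro b hb hby
      by_contra! h
      exact hB'.2 ⟨b, hb, by rwa [hT] at hby, h⟩
    have := degree_monomialIdeal_bounds K (by positivity) hyD (fun g hg ↦ (hG hg).2) hj
      (by omega) hlow hup
    refine ⟨le_trans ?_ this.1, this.2⟩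
    rw [hXr]
    exact Nat.le_ceil x
  refine tsub_le_iff_right.2 ?_
  calc (1 : ENNReal) = μ (E ∪ Eᶜ) := by rw [Set.union_compl_self, hprob]
    _ ≤ μ E + μ Eᶜ := measure_union_le _ _
    _ ≤ μ E + (μ B₁ + μ B₂) := by
        gcongr
        exact hcover.trans (measure_union_le _ _)
    _ ≤ _ := by gcongr

theorem theorem1 (K : Type*) [Field K] (n : ℕ) (k : ℝ) (hk0 : 0 < k) (hkn : k < n)
    (hk : ∀ m : ℤ, k ≠ m) (s : ℕ) (hs : s = ⌊k⌋₊)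
    (p : ℕ → unitInterval) (hp : ∀ D : ℕ, 1 ≤ D → (p D : ℝ) = (D : ℝ) ^ (-k)) :
    ∃ C₁ C₂ : ℝ, 0 < C₁ ∧ 0 < C₂ ∧ ∀ ε : ℝ, 0 < ε →
      Filter.Tendsto
        (fun D : ℕ => RandomMonomialIdeal.randomGenerators n D (p D)
          {G : Set (Fin n →₀ ℕ) |
            ((RandomMonomialIdeal.Z (n - s) ((D : ℝ) ^ (k - s - ε)) : ℝ) <
                (RandomMonomialIdeal.degree (RandomMonomialIdeal.monomialIdeal K G) : ℝ) ∧
              (RandomMonomialIdeal.degree (RandomMonomialIdeal.monomialIdeal K G) : ℝ) <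
                (RandomMonomialIdeal.Z (n - s) ((D : ℝ) ^ (k - s + ε)) : ℝ)) ∧
            (C₁ * (D : ℝ) ^ (k - s - ε) * Real.log D ^ (n - 1) <
                (RandomMonomialIdeal.degree (RandomMonomialIdeal.monomialIdeal K G) : ℝ) ∧
              (RandomMonomialIdeal.degree (RandomMonomialIdeal.monomialIdeal K G) : ℝ) <
                C₂ * (D : ℝ) ^ (k - s + ε) * Real.log D ^ (n - 1))})
        Filter.atTop (nhds 1) := by
  refine ⟨1, 1, one_pos, one_pos, fun ε hε ↦ ?_⟩
  have hsk : (s : ℝ) < k := by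
    refine lt_of_le_of_ne (hs ▸ Nat.floor_le hk0.le) fun h ↦ hk s ?_
    exact_mod_cast h.symm
  have hks : k < s + 1 := hs ▸ Nat.lt_floor_add_one k
  have hsn : s < n := by exact_mod_cast hsk.trans hkn
  -- All powers of `log D` are absorbed in the gap between the exponents `e` and `ε`.
  set e := min ε (min (k - s) (s + 1 - k)) / 2 with he
  have h1 : min ε (min (k - s) (s + 1 - k)) ≤ ε := min_le_left _ _
  have h2 : min ε (min (k - s) (s + 1 - k)) ≤ k - s := (min_le_right _ _).trans (min_le_left _ _)
  have h3 : min ε (min (k - s) (s + 1 - k)) ≤ s + 1 - k :=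
    (min_le_right _ _).trans (min_le_right _ _)
  have h4 : 0 < min ε (min (k - s) (s + 1 - k)) :=
    lt_min hε (lt_min (by linarith) (by linarith))
  refine tendsto_of_tendsto_of_tendsto_of_le_of_le'
    (tendsto_randomGenerators_degree_bounds K hsn (e := e) (by linarith) (by linarith)
      (by linarith) p hp)
    tendsto_const_nhds ?_
    (Eventually.of_forall fun D ↦ by rw [randomGenerators]; exact prob_le_one)
  filter_upwards [eventually_two_mul_log_pow_le n (δ := ε - e) (by linarith),
    (Real.tendsto_log_atTop.comp tendsto_natCast_atTop_atTop).eventually_ge_atTop 1,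
    eventually_ge_atTop 2] with D hδ hlog hD2
  have hD : 1 < (D : ℝ) := by exact_mod_cast hD2
  have hD0 : 0 < (D : ℝ) := by linarith
  have hlog1 : 1 ≤ Real.log D := hlog
  refine measure_mono fun G ⟨hlow, hup⟩ ↦ ?_
  have hLpos : 1 ≤ (2 + Real.log D) ^ n := one_le_pow₀ (by linarith)
  have hpow : ∀ m ≤ n, ∀ u : ℝ, 0 ≤ u → u ≤ 2 + Real.log D → u ^ m < (D : ℝ) ^ (ε - e) := by
    intro m hm u hu0 hu
    have := (pow_le_pow_left₀ hu0 hu m).trans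
      (pow_le_pow_right₀ (by linarith : 1 ≤ 2 + Real.log D) hm)
    linarith
  have hsplit : (D : ℝ) ^ (k - s - ε) * (D : ℝ) ^ (ε - e) = (D : ℝ) ^ (k - s - e) := by
    rw [← Real.rpow_add hD0]
    ring_nf
  have hsplit' : (D : ℝ) ^ (k - s + e) * (D : ℝ) ^ (ε - e) = (D : ℝ) ^ (k - s + ε) := by
    rw [← Real.rpow_add hD0]
    ring_nf
  have hA : ∀ m ≤ n, ∀ u : ℝ, 0 ≤ u → u ≤ 2 + Real.log D →
      (D : ℝ) ^ (k - s - ε) * u ^ m < degree (monomialIdeal K G) := by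
    intro m hm u hu0 hu
    refine lt_of_lt_of_le ?_ hlow
    rw [← hsplit]
    exact mul_lt_mul_of_pos_left (hpow m hm u hu0 hu) (by positivity)
  have hB : 2 * (degree (monomialIdeal K G) : ℝ) ≤ (D : ℝ) ^ (k - s + ε) := by
    rw [← hsplit']
    have h0 : (0 : ℝ) < (D : ℝ) ^ (k - s + e) := by positivity
    nlinarith [mul_le_mul_of_nonneg_left hδ h0.le]
  have hdeg1 : 1 ≤ (degree (monomialIdeal K G) : ℝ) :=
    (Real.one_le_rpow hD.le (by linarith)).trans hlow
  refine ⟨⟨?_, ?_⟩, ?_, ?_⟩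
  · refine (Z_le (by positivity) ?_).trans_lt
      (hA (n - s) (by omega) (1 + Real.log D) (by linarith) (by linarith))
    conv_rhs => rw [← Real.rpow_one (D : ℝ)]
    exact Real.rpow_le_rpow_of_exponent_le hD.le (by linarith)
  · have := sub_one_lt_Z (m := n - s) (by omega)
      (show (0 : ℝ) ≤ (D : ℝ) ^ (k - s + ε) by positivity)
    linarith
  · rw [one_mul]
    exact hA (n - 1) (by omega) _ (by linarith) (by linarith)
  · rw [one_mul]
    have h5 : 1 ≤ Real.log D ^ (n - 1) := one_le_pow₀ hlog1
    have h6 := le_mul_of_one_le_right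
      (show (0 : ℝ) ≤ (D : ℝ) ^ (k - s + ε) by positivity) h5
    linarith
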